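/- Let $G$ be a finite nonabelian group and $H\le G$ a subgroup. For $g\in G$ write $g^H=\{h^{-1}gh : h\in H\}$. Let $\mathbb{C}[G]^H$ be the Schur ring over $G$ whose principal sets are the $H$-classes $g^H$, that is, the subalgebra of $\mathbb{C}[G]$ spanned by the class sums $\sum_{x\in g^H}x$. The pair $(G,H)$ is called a strong Gelfand pair if this Schur ring is commutative. For a Schur ring $\mathcal S$ over a finite group $G$ with principal sets $P_0=\{e\},P_1,\dots,P_d$, let $A_i$ be the $G\times G$ matrix with $(x,y)$ entry $1$ if $yx^{-1}\in P_i$ and $0$ otherwise, and let $E_i^*$ be the diagonal matrix with $(y,y)$ entry $1$ if $y\in P_i$ and $0$ otherwise. The Terwilliger algebra $T(G,\mathcal S)$ (with base point $e$) is the subalgebra of the algebra of complex $G\times G$ matrices generated by all $A_i$ and $E_i^*$. Its standard module is $\mathbb{C}^G$, its modules are the invariant subspaces of $\mathbb{C}^G$, and its primary module is $T(G,\mathcal S)\hat e$, where $\hat e$ is the standard basis vector at $e$. It is called almost commutative if every irreducible module other than the primary module has dimension $1$. For a finite group $K$ write $T(K)=T(K,\mathbb{C}[K]^K)$, the Terwilliger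 algebra for the conjugacy classes of $K$. Suppose that $(G,H)$ is a strong Gelfand pair and that $T(G,\mathbb{C}[G]^H)$ is almost commutative. Then: 1. $T(H)$ is almost commutative; 2. $H$ is normal in $G$; 3. $C_G(H)\le H$; 4. $G/H$ is abelian. -/

import Mathlib

open scoped Pointwise

namespace TerwilligerSGP

noncomputable section

section SchurRings

variable {G : Type*} [Group G] [Fintype G]

/-- The element `∑_{g ∈ P} g` of the group algebra `ℂ[G]`, for a subset `P` of `G`. -/
def simpleQuantity (P : Set G) : MonoidAlgebra ℂ G :=
  ∑ g : G, MonoidAlgebra.single g (P.indicator (fun _ => (1 : ℂ)) g)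

/-- The linear span in `ℂ[G]` of the elements `∑_{g ∈ P} g`, for `P` in a family of subsets. -/
def simpleSpan (C : Set (Set G)) : Submodule ℂ (MonoidAlgebra ℂ G) :=
  Submodule.span ℂ (simpleQuantity '' C)

variable (G) in
/-- A Schur ring over the finite group `G`, given by its principal sets: a partition of `G`
containing `{1}`, closed under inversion, such that the products of the elements
`∑_{g ∈ P} g` are linear combinations of such elements. -/
structure SchurRing where
  /-- The principal sets. -/
  principalSets : Set (Set G)
  isPartition : Setoid.IsPartition principalSets
  one_mem : {1} ∈ principalSets
  inv_mem : ∀ P ∈ principalSets, P⁻¹ ∈ principalSets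
  mul_mem : ∀ P ∈ principalSets, ∀ Q ∈ principalSets,
    simpleQuantity P * simpleQuantity Q ∈ simpleSpan principalSets

theorem simpleQuantity_coeff (P : Set G) (x : G) :
    (simpleQuantity P).coeff x = P.indicator (fun _ => (1 : ℂ)) x := by
  classical
  simp [simpleQuantity, Finsupp.single_apply]

theorem simpleQuantity_one : simpleQuantity ({1} : Set G) = 1 := by
  classical
  ext x
  rw [simpleQuantity_coeff, MonoidAlgebra.one_def]
  simp [Set.indicator_apply, Finsupp.single_apply, eq_comm]

/-- The Schur ring as a subalgebra of `ℂ[G]`. -/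
def SchurRing.toSubalgebra (S : SchurRing G) : Subalgebra ℂ (MonoidAlgebra ℂ G) :=
  Submodule.toSubalgebra (simpleSpan S.principalSets)
    (by
      rw [← simpleQuantity_one]
      exact Submodule.subset_span ⟨_, S.one_mem, rfl⟩)
    (by
      intro a b ha hb
      have h : simpleSpan S.principalSets * simpleSpan S.principalSets ≤
          simpleSpan S.principalSets := by
        conv_lhs => rw [simpleSpan, Submodule.span_mul_span]
        rw [Submodule.span_le]
        rintro _ ⟨_, ⟨P, hP, rfl⟩, _, ⟨Q, hQ, rfl⟩, rfl⟩
        exact S.mul_mem P hP Q hQ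
      exact h (Submodule.mul_mem_mul ha hb))

/-- The Schur ring is a commutative ring. -/
def SchurRing.IsCommutative (S : SchurRing G) : Prop :=
  ∀ a ∈ S.toSubalgebra, ∀ b ∈ S.toSubalgebra, a * b = b * a

end SchurRings

section Classes

variable {G : Type*} [Group G]

/-- The `H`-class `g^H = {h⁻¹ g h : h ∈ H}` of `g`. -/
def hClass (H : Subgroup G) (g : G) : Set G :=
  {x | ∃ h ∈ H, x = h⁻¹ * g * h}

theorem mem_hClass_self (H : Subgroup G) (g : G) : g ∈ hClass H g :=
  ⟨1, H.one_mem, by simp⟩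

theorem hClass_eq_of_mem {H : Subgroup G} {x g : G} (hx : x ∈ hClass H g) :
    hClass H x = hClass H g := by
  obtain ⟨h, hh, rfl⟩ := hx
  ext y
  constructor
  · rintro ⟨k, hk, rfl⟩
    exact ⟨h * k, H.mul_mem hh hk, by group⟩
  · rintro ⟨k, hk, rfl⟩
    exact ⟨h⁻¹ * k, H.mul_mem (H.inv_mem hh) hk, by group⟩

theorem mem_hClass_comm {H : Subgroup G} {x g : G} : x ∈ hClass H g ↔ g ∈ hClass H x :=
  ⟨fun h => hClass_eq_of_mem h ▸ mem_hClass_self H g,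
    fun h => hClass_eq_of_mem h ▸ mem_hClass_self H x⟩

theorem hClass_inv (H : Subgroup G) (g : G) : (hClass H g)⁻¹ = hClass H g⁻¹ := by
  ext y
  rw [Set.mem_inv]
  constructor
  · rintro ⟨h, hh, e⟩
    exact ⟨h, hh, by rw [← inv_inv y, e]; group⟩
  · rintro ⟨h, hh, rfl⟩
    exact ⟨h, hh, by group⟩

theorem hClass_one (H : Subgroup G) : hClass H 1 = {1} := by
  ext y
  constructor
  · rintro ⟨h, hh, rfl⟩
    simp
  · rintro rfl
    exact mem_hClass_self H 1

theorem conj_mem_hClass {H : Subgroup G} {h : G} (hh : h ∈ H) (x g : G) :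
    h⁻¹ * x * h ∈ hClass H g ↔ x ∈ hClass H g := by
  have hx : h⁻¹ * x * h ∈ hClass H x := ⟨h, hh, rfl⟩
  rw [mem_hClass_comm, hClass_eq_of_mem hx, mem_hClass_comm]

variable [Fintype G]

/-- An element of `ℂ[G]` that is constant on `H`-classes is a combination of class sums. -/
theorem mem_simpleSpan_of_invariant (H : Subgroup G) (f : MonoidAlgebra ℂ G)
    (hf : ∀ h ∈ H, ∀ x, f.coeff (h⁻¹ * x * h) = f.coeff x) :
    f ∈ simpleSpan (Set.range (hClass H)) := by
  classical
  have key : f = ∑ g : G,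
      (f.coeff g / ((Finset.univ.filter (· ∈ hClass H g)).card : ℂ)) •
        simpleQuantity (hClass H g) := by
    ext x
    have hc : ((Finset.univ.filter (· ∈ hClass H x)).card : ℂ) ≠ 0 := by
      rw [Nat.cast_ne_zero, Finset.card_ne_zero]
      exact ⟨x, by simp [mem_hClass_self]⟩
    have hg : ∀ g : G, (f.coeff g / ((Finset.univ.filter (· ∈ hClass H g)).card : ℂ)) *
        (simpleQuantity (hClass H g)).coeff x =
        if g ∈ hClass H x then
          f.coeff x / ((Finset.univ.filter (· ∈ hClass H x)).card : ℂ) else 0 := by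
      intro g
      rw [simpleQuantity_coeff, Set.indicator_apply]
      by_cases hgx : g ∈ hClass H x
      · rw [if_pos (mem_hClass_comm.1 hgx), if_pos hgx, mul_one, hClass_eq_of_mem hgx]
        obtain ⟨h, hh, rfl⟩ := hgx
        rw [hf h hh]
      · rw [if_neg (fun h => hgx (mem_hClass_comm.1 h)), if_neg hgx, mul_zero]
    simp only [MonoidAlgebra.coeff_sum, MonoidAlgebra.coeff_smul, Finsupp.finsetSum_apply,
      Finsupp.smul_apply, smul_eq_mul, hg]
    rw [← Finset.sum_filter, Finset.sum_const, nsmul_eq_mul]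
    field_simp
  rw [key]
  exact Submodule.sum_mem _ fun g _ => Submodule.smul_mem _ _
    (Submodule.subset_span ⟨_, ⟨g, rfl⟩, rfl⟩)

/-- The Schur ring `ℂ[G]^H`, whose principal sets are the `H`-classes of `G`. -/
def classSchurRing (H : Subgroup G) : SchurRing G where
  principalSets := Set.range (hClass H)
  isPartition := by
    refine ⟨?_, fun a => ⟨hClass H a, ⟨⟨a, rfl⟩, mem_hClass_self H a⟩, ?_⟩⟩
    · rintro ⟨g, hg⟩
      exact (hg ▸ mem_hClass_self H g : g ∈ (∅ : Set G))
    · rintro _ ⟨⟨g, rfl⟩, hg⟩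
      exact (hClass_eq_of_mem hg).symm
  one_mem := ⟨1, hClass_one H⟩
  inv_mem := by
    rintro _ ⟨g, rfl⟩
    exact ⟨g⁻¹, (hClass_inv H g).symm⟩
  mul_mem := by
    classical
    rintro _ ⟨a, rfl⟩ _ ⟨b, rfl⟩
    refine mem_simpleSpan_of_invariant H _ fun h hh x => ?_
    have hmul : ∀ y : G, (simpleQuantity (hClass H a) * simpleQuantity (hClass H b)).coeff y =
        ∑ g : G, (hClass H a).indicator (fun _ => (1 : ℂ)) g *
          (hClass H b).indicator (fun _ => (1 : ℂ)) (g⁻¹ * y) := by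
      intro y
      conv_lhs => rw [simpleQuantity, Finset.sum_mul, MonoidAlgebra.coeff_sum,
        Finsupp.finsetSum_apply]
      refine Finset.sum_congr rfl fun g _ => ?_
      rw [MonoidAlgebra.coeff_single_mul_apply, simpleQuantity_coeff]
    have hind : ∀ c y : G, (hClass H c).indicator (fun _ => (1 : ℂ)) (h⁻¹ * y * h) =
        (hClass H c).indicator (fun _ => (1 : ℂ)) y := by
      intro c y
      simp only [Set.indicator_apply, conj_mem_hClass hh]
    rw [hmul, hmul]
    refine Fintype.sum_equiv (MulAut.conj h).toEquiv _ _ fun g => ?_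
    have e1 : h⁻¹ * (MulAut.conj h).toEquiv g * h = g := by
      simp [MulAut.conj_apply, mul_assoc]
    have e2 : h⁻¹ * (((MulAut.conj h).toEquiv g)⁻¹ * x) * h = g⁻¹ * (h⁻¹ * x * h) := by
      simp [MulAut.conj_apply, mul_assoc]
    rw [← hind a ((MulAut.conj h).toEquiv g), ← hind b (((MulAut.conj h).toEquiv g)⁻¹ * x),
      e1, e2]

/-- `(G, H)` is a strong Gelfand pair: the Schur ring of `H`-classes is commutative. -/
def IsStrongGelfandPair (H : Subgroup G) : Prop :=
  (classSchurRing H).IsCommutative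

variable (G) in
/-- The Schur ring `ℂ[G]^G` of the group association scheme: its principal sets are the
conjugacy classes of `G`. -/
def groupSchurRing : SchurRing G := classSchurRing (⊤ : Subgroup G)

end Classes

section Terwilliger

variable {G : Type*} [Group G]

/-- The adjacency matrix of the relation `{(x, y) : y x⁻¹ ∈ P}`. -/
def adjacency (P : Set G) : Matrix G G ℂ :=
  Matrix.of fun x y => P.indicator (fun _ => (1 : ℂ)) (y * x⁻¹)

variable [DecidableEq G]

/-- The dual idempotent of `P` with base point `1`: the diagonal matrix whose `(y, y)` entry is
the `(1, y)` entry of the adjacency matrix of `P`. -/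
def dualIdempotent (P : Set G) : Matrix G G ℂ :=
  Matrix.diagonal fun y => adjacency P 1 y

/-- The Terwilliger algebra `T(G, S)` with base point `1`: the algebra of matrices generated by
the adjacency matrices and the dual idempotents of the principal sets of `S`. -/
def terwilligerAlgebra [Fintype G] (S : SchurRing G) : Subalgebra ℂ (Matrix G G ℂ) :=
  Algebra.adjoin ℂ (adjacency '' S.principalSets ∪ dualIdempotent '' S.principalSets)

end Terwilliger

section AlmostCommutative

variable {X : Type*} [Fintype X] [DecidableEq X]

/-- `W` is a submodule of the standard module `ℂ^X` of the matrix algebra `T`. -/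
def IsTModule (T : Subalgebra ℂ (Matrix X X ℂ)) (W : Submodule ℂ (X → ℂ)) : Prop :=
  ∀ M ∈ T, ∀ v ∈ W, M.mulVec v ∈ W

/-- `W` is an irreducible `T`-module: it is nonzero and has no `T`-submodule except `0`
and itself. -/
def IsIrreducibleTModule (T : Subalgebra ℂ (Matrix X X ℂ)) (W : Submodule ℂ (X → ℂ)) : Prop :=
  IsTModule T W ∧ W ≠ ⊥ ∧ ∀ U : Submodule ℂ (X → ℂ), IsTModule T U → U ≤ W → U = ⊥ ∨ U = W

/-- The primary module `T x̂`, where `x̂` is the standard basis vector at the base point `x`. -/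
def primaryModule (T : Subalgebra ℂ (Matrix X X ℂ)) (x : X) : Submodule ℂ (X → ℂ) :=
  Submodule.span ℂ {v | ∃ M ∈ T, v = M.mulVec (Pi.single x 1)}

/-- The Terwilliger algebra `T` with base point `x` is almost commutative: every irreducible
`T`-module other than the primary one has dimension one. -/
def IsAlmostCommutative (T : Subalgebra ℂ (Matrix X X ℂ)) (x : X) : Prop :=
  ∀ W : Submodule ℂ (X → ℂ), IsIrreducibleTModule T W → W ≠ primaryModule T x →
    Module.finrank ℂ W = 1

end AlmostCommutative

end

end TerwilligerSGP

/-! Almost commutativity becomes a combinatorial block condition: for distinct principal sets `P`,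
`Q`, all quotients `y * x⁻¹` with `x ∈ P`, `y ∈ Q` lie in one principal set
(`SchurRing.mul_inv_mem_of_isAlmostCommutative`). The reason is that the standard module is spanned
by the primary module, whose functions are constant on principal sets, and by common eigenvectors,
which are killed by the off-diagonal blocks of the adjacency matrices.

Conversely, the block condition together with commuting adjacency matrices forces almost
commutativity (`SchurRing.isAlmostCommutative`). The conjugacy classes of `H` are `H`-classes of
`G`, so the condition for `(G, H)` restricts to `H`, where class sums always commute.

The other claims are group theory. Comparing `g` with `z * g` for `z` centralizing `H`, or with `h *
g` for `h ∈ H`, gives `centralizer_le_of_quotient_mem` and `normal_of_quotient_mem`. Commutativity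
of the Schur ring then makes the quotient abelian, since each `H`-class collapses to a point there.
-/

namespace TerwilligerSGP

open Matrix

/-! ### Modules of self-adjoint matrix algebras. -/

section Modules

variable {X : Type*} [Fintype X]

/-- The orthogonal complement of a subspace of `ℂ^X` for the standard Hermitian form. -/
def hermitianOrthogonal (U : Submodule ℂ (X → ℂ)) : Submodule ℂ (X → ℂ) where
  carrier := {v | ∀ u ∈ U, star u ⬝ᵥ v = 0}
  zero_mem' := fun u _ => dotProduct_zero _
  add_mem' := fun {v w} hv hw u hu => by rw [dotProduct_add, hv u hu, hw u hu, add_zero]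
  smul_mem' := fun c v hv u hu => by rw [dotProduct_smul, hv u hu, smul_zero]

theorem inf_hermitianOrthogonal (U : Submodule ℂ (X → ℂ)) : U ⊓ hermitianOrthogonal U = ⊥ := by
  rw [eq_bot_iff]
  rintro v ⟨hv, hv'⟩
  open scoped ComplexOrder in
  exact dotProduct_star_self_eq_zero.1 (hv' v hv)

variable [DecidableEq X]

theorem isTModule_adjoin {s : Set (Matrix X X ℂ)} {W : Submodule ℂ (X → ℂ)}
    (h : ∀ M ∈ s, ∀ v ∈ W, M *ᵥ v ∈ W) : IsTModule (Algebra.adjoin ℂ s) W := by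
  intro M hM
  induction hM using Algebra.adjoin_induction with
  | mem M hM => exact h M hM
  | algebraMap r =>
    intro v hv
    rw [Algebra.algebraMap_eq_smul_one, smul_mulVec, one_mulVec]
    exact W.smul_mem _ hv
  | add M N _ _ hM hN =>
    intro v hv
    rw [add_mulVec]
    exact W.add_mem (hM v hv) (hN v hv)
  | mul M N _ _ hM hN =>
    intro v hv
    rw [← mulVec_mulVec]
    exact hM _ (hN v hv)

theorem isTModule_primaryModule (T : Subalgebra ℂ (Matrix X X ℂ)) (x : X) :
    IsTModule T (primaryModule T x) := by
  intro M hM v hv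
  refine Submodule.span_induction (p := fun v _ => M *ᵥ v ∈ primaryModule T x)
    ?_ ?_ ?_ ?_ hv
  · rintro _ ⟨N, hN, rfl⟩
    rw [mulVec_mulVec]
    exact Submodule.subset_span ⟨_, T.mul_mem hM hN, rfl⟩
  · rw [mulVec_zero]
    exact Submodule.zero_mem _
  · intro u v _ _ hu hv
    rw [mulVec_add]
    exact Submodule.add_mem _ hu hv
  · intro c v _ hv
    rw [mulVec_smul]
    exact Submodule.smul_mem _ _ hv

theorem single_mem_primaryModule (T : Subalgebra ℂ (Matrix X X ℂ)) (x : X) :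
    Pi.single x 1 ∈ primaryModule T x :=
  Submodule.subset_span ⟨1, T.one_mem, (one_mulVec _).symm⟩

theorem primaryModule_le {T : Subalgebra ℂ (Matrix X X ℂ)} {x : X} {W : Submodule ℂ (X → ℂ)}
    (hW : IsTModule T W) (hx : Pi.single x 1 ∈ W) : primaryModule T x ≤ W := by
  refine Submodule.span_le.2 ?_
  rintro _ ⟨M, hM, rfl⟩
  exact hW M hM _ hx

theorem IsIrreducibleTModule.single_notMem {T : Subalgebra ℂ (Matrix X X ℂ)} {x : X}
    {W : Submodule ℂ (X → ℂ)} (hW : IsIrreducibleTModule T W) (hne : W ≠ primaryModule T x) :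
    Pi.single x 1 ∉ W := by
  intro hx
  rcases hW.2.2 _ (isTModule_primaryModule T x) (primaryModule_le hW.1 hx) with h | h
  · have := single_mem_primaryModule T x
    rw [h, Submodule.mem_bot] at this
    simpa using congrFun this x
  · exact hne h.symm

theorem exists_isIrreducibleTModule_le {T : Subalgebra ℂ (Matrix X X ℂ)}
    {W : Submodule ℂ (X → ℂ)} (hW : IsTModule T W) (hne : W ≠ ⊥) :
    ∃ U ≤ W, IsIrreducibleTModule T U := by
  obtain ⟨U, ⟨hUT, hU, hUW⟩, hmin⟩ := WellFounded.has_min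
    (wellFounded_lt : WellFounded ((· < ·) : Submodule ℂ (X → ℂ) → _ → Prop))
    {U | IsTModule T U ∧ U ≠ ⊥ ∧ U ≤ W} ⟨W, hW, hne, le_rfl⟩
  refine ⟨U, hUW, hUT, hU, fun V hV hVU => ?_⟩
  by_contra! h
  exact hmin V ⟨hV, h.1, hVU.trans hUW⟩ (lt_of_le_of_ne hVU h.2)

theorem hermitianOrthogonal_ne_bot {U : Submodule ℂ (X → ℂ)} (hU : U ≠ ⊤) :
    hermitianOrthogonal U ≠ ⊥ := by
  obtain ⟨f, hf, hUf⟩ := Submodule.exists_le_ker_of_lt_top U (lt_top_iff_ne_top.2 hU)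
  have hfc : ∀ u, f u = u ⬝ᵥ fun x => f (Pi.single x 1) := by
    intro u
    conv_lhs => rw [← Finset.univ_sum_single u]
    rw [map_sum]
    refine Finset.sum_congr rfl fun x _ => ?_
    rw [← smul_eq_mul, ← map_smul, ← Pi.single_smul, smul_eq_mul, mul_one]
  intro h
  -- The conjugated coefficient vector of a nonzero functional vanishing on `U` is orthogonal to
  -- `U`.
  have hmem : star (fun x => f (Pi.single x 1)) ∈ hermitianOrthogonal U := by
    intro u hu
    rw [dotProduct_star, star_star, dotProduct_comm, ← hfc, LinearMap.mem_ker.1 (hUf hu),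
      star_zero]
  rw [h, Submodule.mem_bot, star_eq_zero] at hmem
  refine hf (LinearMap.ext fun u => ?_)
  rw [hfc, hmem, dotProduct_zero, LinearMap.zero_apply]

theorem isTModule_hermitianOrthogonal {s : Set (Matrix X X ℂ)} (hs : ∀ M ∈ s, Mᴴ ∈ s)
    {U : Submodule ℂ (X → ℂ)} (hU : IsTModule (Algebra.adjoin ℂ s) U) :
    IsTModule (Algebra.adjoin ℂ s) (hermitianOrthogonal U) := by
  refine isTModule_adjoin fun M hM v hv u hu => ?_
  rw [dotProduct_mulVec, ← conjTranspose_conjTranspose M, ← star_mulVec]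
  exact hv _ (hU _ (Algebra.subset_adjoin (hs M hM)) u hu)

/-- For an almost commutative algebra with a self-adjoint set of generators, the standard module
is spanned by the primary module and common eigenvectors. -/
theorem primaryModule_sup_eigenvectors_eq_top {s : Set (Matrix X X ℂ)}
    (hs : ∀ M ∈ s, Mᴴ ∈ s) {x : X} (h : IsAlmostCommutative (Algebra.adjoin ℂ s) x) :
    primaryModule (Algebra.adjoin ℂ s) x ⊔
      Submodule.span ℂ {v | ∀ M ∈ Algebra.adjoin ℂ s, ∃ c : ℂ, M *ᵥ v = c • v} = ⊤ := by
  set T := Algebra.adjoin ℂ s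
  set V := Submodule.span ℂ {v : X → ℂ | ∀ M ∈ T, ∃ c : ℂ, M *ᵥ v = c • v} with hV
  have hVT : IsTModule T V := by
    intro M hM v hv
    refine Submodule.span_induction (p := fun v _ => M *ᵥ v ∈ V) ?_ ?_ ?_ ?_ hv
    · intro v hv
      obtain ⟨c, hc⟩ := hv M hM
      rw [hc]
      exact V.smul_mem _ (Submodule.subset_span hv)
    · rw [mulVec_zero]
      exact V.zero_mem
    · intro u v _ _ hu hv
      rw [mulVec_add]
      exact V.add_mem hu hv
    · intro c v _ hv
      rw [mulVec_smul]
      exact V.smul_mem _ hv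
  have hUT : IsTModule T (primaryModule T x ⊔ V) := by
    intro M hM v hv
    obtain ⟨p, hp, q, hq, rfl⟩ := Submodule.mem_sup.1 hv
    rw [mulVec_add]
    exact Submodule.add_mem_sup (isTModule_primaryModule T x M hM p hp) (hVT M hM q hq)
  by_contra hne
  -- An irreducible `W` in the orthogonal complement is not primary, hence is a line; its vectors
  -- are then common eigenvectors, so `W` lies in `V` as well and must vanish.
  obtain ⟨W, hWU, hW⟩ := exists_isIrreducibleTModule_le (isTModule_hermitianOrthogonal hs hUT)
    (hermitianOrthogonal_ne_bot hne)
  have hdisj : ∀ w ∈ W, w ∈ primaryModule T x ⊔ V → w = 0 := by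
    intro w hw hwU
    have : w ∈ (primaryModule T x ⊔ V) ⊓ hermitianOrthogonal (primaryModule T x ⊔ V) :=
      ⟨hwU, hWU hw⟩
    rwa [inf_hermitianOrthogonal] at this
  have hWp : W ≠ primaryModule T x := by
    rintro rfl
    exact hW.2.1 ((Submodule.eq_bot_iff _).2 fun w hw =>
      hdisj w hw ((le_sup_left : _ ≤ primaryModule T x ⊔ V) hw))
  have hdim := h W hW hWp
  refine hW.2.1 ((Submodule.eq_bot_iff _).2 fun w hw => hdisj w hw ?_)
  refine (le_sup_right : V ≤ primaryModule T x ⊔ V) ?_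
  by_cases hw0 : w = 0
  · rw [hw0]
    exact V.zero_mem
  refine Submodule.subset_span fun M hM => ?_
  obtain ⟨c, hc⟩ := (finrank_eq_one_iff_of_nonzero' (⟨w, hw⟩ : W)
    (by simpa [Subtype.ext_iff] using hw0)).1 hdim ⟨M *ᵥ w, hW.1 M hM w hw⟩
  exact ⟨c, (congrArg Subtype.val hc).symm⟩

/-- An irreducible module on which the generators commute has dimension one. -/
theorem IsIrreducibleTModule.finrank_eq_one {s : Set (Matrix X X ℂ)} {W : Submodule ℂ (X → ℂ)}
    (hW : IsIrreducibleTModule (Algebra.adjoin ℂ s) W)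
    (hcomm : ∀ M ∈ s, ∀ N ∈ s, ∀ w ∈ W, M *ᵥ (N *ᵥ w) = N *ᵥ (M *ᵥ w)) :
    Module.finrank ℂ W = 1 := by
  obtain ⟨hWT, hWne, hirr⟩ := hW
  have hgen : ∀ M ∈ s, ∀ w ∈ W, M *ᵥ w ∈ W := fun M hM => hWT M (Algebra.subset_adjoin hM)
  have hscalar : ∀ M ∈ s, ∃ c : ℂ, ∀ w ∈ W, M *ᵥ w = c • w := by
    intro M hM
    have : Nontrivial W := Submodule.nontrivial_iff_ne_bot.2 hWne
    obtain ⟨c, hc⟩ := Module.End.exists_eigenvalue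
      ((mulVecLin M).restrict (p := W) (q := W) (hgen M hM))
    obtain ⟨w, hw⟩ := hc.exists_hasEigenvector
    have hw1 : M *ᵥ (w : X → ℂ) = c • (w : X → ℂ) := congrArg Subtype.val hw.apply_eq_smul
    -- Schur's argument: the eigenspace of `M` in `W` is stable under the commuting generators, so
    -- it is all of `W`.
    let U : Submodule ℂ (X → ℂ) := W ⊓ LinearMap.eqLocus (mulVecLin M) (c • LinearMap.id)
    have hU : IsTModule (Algebra.adjoin ℂ s) U := by
      refine isTModule_adjoin fun N hN v hv => ⟨hgen N hN v hv.1, ?_⟩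
      have h2 : M *ᵥ v = c • v := hv.2
      change M *ᵥ (N *ᵥ v) = c • (N *ᵥ v)
      rw [hcomm M hM N hN v hv.1, h2, mulVec_smul]
    refine ⟨c, fun v hv => ?_⟩
    rcases hirr U hU inf_le_left with h | h
    · have hwU : (w : X → ℂ) ∈ U := ⟨w.2, hw1⟩
      rw [h, Submodule.mem_bot] at hwU
      exact absurd (Subtype.ext hwU) hw.2
    · rw [← h] at hv
      exact hv.2
  obtain ⟨v, hv, hv0⟩ := Submodule.exists_mem_ne_zero_of_ne_bot hWne
  have hspan : IsTModule (Algebra.adjoin ℂ s) (Submodule.span ℂ {v}) := by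
    refine isTModule_adjoin fun M hM u hu => ?_
    obtain ⟨c, hc⟩ := hscalar M hM
    rw [hc u ((Submodule.span_singleton_le_iff_mem v W).2 hv hu)]
    exact Submodule.smul_mem _ _ hu
  rcases hirr _ hspan ((Submodule.span_singleton_le_iff_mem v W).2 hv) with h | h
  · exact absurd (Submodule.span_singleton_eq_bot.1 h) hv0
  · rw [← h, finrank_span_singleton hv0]

end Modules

/-! ### Almost commutativity of a Schur ring and the block condition. -/

section SchurRings

variable {G : Type*} [Group G]

theorem adjacency_apply (P : Set G) (x y : G) :
    adjacency P x y = P.indicator (fun _ => (1 : ℂ)) (y * x⁻¹) :=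
  rfl

theorem conjTranspose_adjacency (P : Set G) : (adjacency P)ᴴ = adjacency P⁻¹ := by
  classical
  ext x y
  rw [conjTranspose_apply, adjacency_apply, adjacency_apply, Set.indicator_apply,
    Set.indicator_apply]
  have : x * y⁻¹ ∈ P ↔ y * x⁻¹ ∈ P⁻¹ := by simp
  simp only [this]
  split_ifs <;> simp

variable [Fintype G]

theorem SchurRing.eq_of_mem (S : SchurRing G) {P Q : Set G} (hP : P ∈ S.principalSets)
    (hQ : Q ∈ S.principalSets) {x : G} (hxP : x ∈ P) (hxQ : x ∈ Q) : P = Q :=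
  (S.isPartition.2 x).unique ⟨hP, hxP⟩ ⟨hQ, hxQ⟩

theorem SchurRing.mem_iff_mem (S : SchurRing G) {P Q : Set G} (hP : P ∈ S.principalSets)
    (hQ : Q ∈ S.principalSets) {x y : G} (hx : x ∈ P) (hy : y ∈ P) : x ∈ Q ↔ y ∈ Q :=
  ⟨fun h => S.eq_of_mem hP hQ hx h ▸ hy, fun h => S.eq_of_mem hP hQ hy h ▸ hx⟩

/-- The inverse appears because `y * x⁻¹ ∈ P` means `y = g⁻¹ * x` with `g ∈ P⁻¹`. -/
theorem adjacency_mulVec_coeff (P : Set G) (a : MonoidAlgebra ℂ G) :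
    adjacency P *ᵥ (fun g => a.coeff g) = fun g => (simpleQuantity P⁻¹ * a).coeff g := by
  classical
  ext x
  rw [simpleQuantity, Finset.sum_mul, MonoidAlgebra.coeff_sum, Finsupp.finsetSum_apply, mulVec,
    dotProduct]
  refine Fintype.sum_equiv ((Equiv.inv G).trans (Equiv.mulLeft x)) _ _ fun y => ?_
  rw [MonoidAlgebra.coeff_single_mul_apply, adjacency_apply, Set.indicator_apply,
    Set.indicator_apply]
  simp

/-- A function constant on principal sets is orthogonal to a function whose sum over every
principal set vanishes. -/
theorem SchurRing.sum_mul_eq_zero (S : SchurRing G) {c w : G → ℂ}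
    (hc : ∀ P ∈ S.principalSets, ∀ x ∈ P, ∀ y ∈ P, c x = c y)
    (hw : ∀ P ∈ S.principalSets, ∑ y, P.indicator (fun _ => (1 : ℂ)) y * w y = 0) :
    ∑ y, c y * w y = 0 := by
  classical
  choose f hf hfu using S.isPartition.2
  rw [← Finset.sum_fiberwise_of_maps_to (t := Finset.univ.image f) (g := f)
    (fun y _ => Finset.mem_image_of_mem f (Finset.mem_univ y))]
  refine Finset.sum_eq_zero fun P hP => ?_
  obtain ⟨x, -, rfl⟩ := Finset.mem_image.1 hP
  have h := hw (f x) (hf x).1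
  have hiff : ∀ y, f y = f x ↔ y ∈ f x := fun y =>
    ⟨fun e => e ▸ (hf y).2, fun hy => S.eq_of_mem (hf y).1 (hf x).1 (hf y).2 hy⟩
  calc ∑ y ∈ Finset.univ with f y = f x, c y * w y
      = ∑ y, c x * ((f x).indicator (fun _ => (1 : ℂ)) y * w y) := by
        rw [Finset.sum_filter]
        refine Finset.sum_congr rfl fun y _ => ?_
        simp only [hiff, Set.indicator_apply]
        split_ifs with hy
        · rw [one_mul, hc _ (hf x).1 y hy x (hf x).2]
        · simp
    _ = 0 := by rw [← Finset.mul_sum, h, mul_zero]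

variable [DecidableEq G]

theorem dualIdempotent_mulVec (P : Set G) (v : G → ℂ) (x : G) :
    (dualIdempotent P *ᵥ v) x = P.indicator (fun _ => (1 : ℂ)) x * v x := by
  rw [dualIdempotent, mulVec_diagonal, adjacency_apply, inv_one, mul_one]

theorem conjTranspose_dualIdempotent (P : Set G) : (dualIdempotent P)ᴴ = dualIdempotent P := by
  classical
  rw [dualIdempotent, diagonal_conjTranspose]
  congr 1
  ext x
  rw [Pi.star_apply, adjacency_apply, Set.indicator_apply]
  split_ifs <;> simp

theorem conjTranspose_mem_generators (S : SchurRing G) :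
    ∀ M ∈ adjacency '' S.principalSets ∪ dualIdempotent '' S.principalSets,
      Mᴴ ∈ adjacency '' S.principalSets ∪ dualIdempotent '' S.principalSets := by
  rintro _ (⟨P, hP, rfl⟩ | ⟨P, hP, rfl⟩)
  · exact Or.inl ⟨P⁻¹, S.inv_mem P hP, (conjTranspose_adjacency P).symm⟩
  · exact Or.inr ⟨P, hP, (conjTranspose_dualIdempotent P).symm⟩

theorem SchurRing.adjacency_mem (S : SchurRing G) {P : Set G} (hP : P ∈ S.principalSets) :
    adjacency P ∈ terwilligerAlgebra S :=
  Algebra.subset_adjoin (Or.inl ⟨P, hP, rfl⟩)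

theorem SchurRing.dualIdempotent_mem (S : SchurRing G) {P : Set G} (hP : P ∈ S.principalSets) :
    dualIdempotent P ∈ terwilligerAlgebra S :=
  Algebra.subset_adjoin (Or.inr ⟨P, hP, rfl⟩)

/-- The functions in the primary module are constant on the principal sets. -/
theorem SchurRing.eq_of_mem_primaryModule (S : SchurRing G) {v : G → ℂ}
    (hv : v ∈ primaryModule (terwilligerAlgebra S) 1) {P : Set G} (hP : P ∈ S.principalSets)
    {x y : G} (hx : x ∈ P) (hy : y ∈ P) : v x = v y := by
  classical
  let L : MonoidAlgebra ℂ G →ₗ[ℂ] (G → ℂ) :=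
    { toFun := fun a g => a.coeff g
      map_add' := fun a b => by ext; simp
      map_smul' := fun c a => by ext; simp }
  have hL : ∀ Q : Set G, L (simpleQuantity Q) = Q.indicator fun _ => 1 := fun Q =>
    funext fun g => simpleQuantity_coeff Q g
  -- The Schur ring, viewed as a space of functions, is a module containing the base vector, so it
  -- contains the primary module.
  let N := (simpleSpan S.principalSets).map L
  have hN : IsTModule (terwilligerAlgebra S) N := by
    refine isTModule_adjoin ?_
    rintro _ (⟨Q, hQ, rfl⟩ | ⟨Q, hQ, rfl⟩) _ ⟨a, ha, rfl⟩
    · refine ⟨simpleQuantity Q⁻¹ * a, ?_, (adjacency_mulVec_coeff Q a).symm⟩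
      exact S.toSubalgebra.mul_mem (Submodule.subset_span ⟨_, S.inv_mem Q hQ, rfl⟩) ha
    · refine Submodule.span_induction (p := fun a _ => dualIdempotent Q *ᵥ L a ∈ N)
        ?_ ?_ ?_ ?_ ha
      · rintro _ ⟨R, hR, rfl⟩
        by_cases hQR : R = Q
        · subst hQR
          refine ⟨simpleQuantity R, Submodule.subset_span ⟨_, hR, rfl⟩, ?_⟩
          ext g
          rw [dualIdempotent_mulVec, hL, Set.indicator_apply]
          split_ifs <;> simp
        · convert N.zero_mem
          ext g
          rw [dualIdempotent_mulVec, hL, Set.indicator_apply, Set.indicator_apply]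
          split_ifs with h1 h2
          · exact absurd (S.eq_of_mem hR hQ h2 h1) hQR
          all_goals simp
      · rw [map_zero, mulVec_zero]
        exact N.zero_mem
      · intro a b _ _ ha hb
        rw [map_add, mulVec_add]
        exact N.add_mem ha hb
      · intro c a _ ha
        rw [map_smul, mulVec_smul]
        exact N.smul_mem _ ha
  have h1 : Pi.single 1 1 ∈ N := by
    refine ⟨simpleQuantity {1}, Submodule.subset_span ⟨_, S.one_mem, rfl⟩, ?_⟩
    ext g
    rw [hL]
    simp [Set.indicator_apply, Pi.single_apply]
  obtain ⟨a, ha, rfl⟩ := primaryModule_le hN h1 hv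
  refine Submodule.span_induction (p := fun a _ => L a x = L a y) ?_ rfl ?_ ?_ ha
  · rintro _ ⟨Q, hQ, rfl⟩
    rw [hL, Set.indicator_apply, Set.indicator_apply]
    simp only [S.mem_iff_mem hP hQ hx hy]
  · intro a b _ _ ha hb
    rw [map_add, Pi.add_apply, Pi.add_apply, ha, hb]
  · intro c a _ ha
    rw [map_smul, Pi.smul_apply, Pi.smul_apply, ha]

/-- If the Terwilliger algebra is almost commutative, then the quotients of elements of two
distinct principal sets lie in a single principal set: rows. -/
theorem SchurRing.mul_inv_mem_of_mem_left (S : SchurRing G)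
    (h : IsAlmostCommutative (terwilligerAlgebra S) 1) {P Q R : Set G}
    (hP : P ∈ S.principalSets) (hQ : Q ∈ S.principalSets) (hR : R ∈ S.principalSets)
    (hPQ : P ≠ Q) {x x' y : G} (hx : x ∈ P) (hx' : x' ∈ P) (hy : y ∈ Q)
    (hxy : y * x⁻¹ ∈ R) : y * x'⁻¹ ∈ R := by
  classical
  have key : ∀ v : G → ℂ, (adjacency R *ᵥ (dualIdempotent Q *ᵥ v)) x =
      (adjacency R *ᵥ (dualIdempotent Q *ᵥ v)) x' := by
    intro v
    have hv : v ∈ (⊤ : Submodule ℂ (G → ℂ)) := trivial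
    rw [← primaryModule_sup_eigenvectors_eq_top (conjTranspose_mem_generators S) h] at hv
    obtain ⟨p, hp, q, hq, rfl⟩ := Submodule.mem_sup.1 hv
    have hpz := S.eq_of_mem_primaryModule (isTModule_primaryModule _ _ _ (S.adjacency_mem hR) _
      (isTModule_primaryModule _ _ _ (S.dualIdempotent_mem hQ) p hp)) hP hx hx'
    have hqz : ∀ z ∈ P, (adjacency R *ᵥ (dualIdempotent Q *ᵥ q)) z = 0 := by
      intro z hz
      refine Submodule.span_induction
        (p := fun q _ => (adjacency R *ᵥ (dualIdempotent Q *ᵥ q)) z = 0) ?_ ?_ ?_ ?_ hq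
      · intro u hu
        obtain ⟨b, hb⟩ := hu _ (S.dualIdempotent_mem hQ)
        obtain ⟨c, hc⟩ := hu _ (S.adjacency_mem hR)
        -- Since `z ∉ Q`, an eigenvector `u` of the dual idempotent of `Q` has eigenvalue `0` or
        -- vanishes at `z`.
        have hbz : b * u z = 0 := by
          rw [← smul_eq_mul, ← Pi.smul_apply, ← hb, dualIdempotent_mulVec,
            Set.indicator_of_notMem fun hzQ => hPQ (S.eq_of_mem hP hQ hz hzQ), zero_mul]
        rw [hb, mulVec_smul, hc, Pi.smul_apply, Pi.smul_apply, smul_eq_mul, smul_eq_mul,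
          mul_left_comm, hbz, mul_zero]
      · simp
      · intro u v _ _ hu hv
        rw [mulVec_add, mulVec_add, Pi.add_apply, hu, hv, add_zero]
      · intro c u _ hu
        rw [mulVec_smul, mulVec_smul, Pi.smul_apply, hu, smul_zero]
    rw [mulVec_add, mulVec_add, Pi.add_apply, Pi.add_apply, hpz, hqz x hx, hqz x' hx']
  have hsingle : dualIdempotent Q *ᵥ Pi.single y 1 = Pi.single y 1 := by
    ext z
    rw [dualIdempotent_mulVec]
    by_cases hz : z = y
    · rw [hz, Set.indicator_of_mem hy, one_mul]
    · rw [Pi.single_eq_of_ne hz, mul_zero]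
  -- The basis vector at `y` extracts the entries `(x, y)` and `(x', y)` of the adjacency matrix.
  have hxx := key (Pi.single y 1)
  rw [hsingle, mulVec_single_one, col_apply, col_apply, adjacency_apply, adjacency_apply,
    Set.indicator_of_mem hxy] at hxx
  by_contra hn
  rw [Set.indicator_of_notMem hn] at hxx
  exact one_ne_zero hxx

/-- If the Terwilliger algebra is almost commutative, then the quotients of elements of two
distinct principal sets lie in a single principal set. -/
theorem SchurRing.mul_inv_mem_of_isAlmostCommutative (S : SchurRing G)
    (h : IsAlmostCommutative (terwilligerAlgebra S) 1) {P Q R : Set G}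
    (hP : P ∈ S.principalSets) (hQ : Q ∈ S.principalSets) (hR : R ∈ S.principalSets)
    (hPQ : P ≠ Q) {x x' y y' : G} (hx : x ∈ P) (hx' : x' ∈ P) (hy : y ∈ Q) (hy' : y' ∈ Q)
    (hxy : y * x⁻¹ ∈ R) : y' * x'⁻¹ ∈ R := by
  have h1 := S.mul_inv_mem_of_mem_left h hP hQ hR hPQ hx hx' hy hxy
  have h2 := S.mul_inv_mem_of_mem_left (R := R⁻¹) h hQ hP (S.inv_mem R hR) hPQ.symm hy hy' hx'
    (by simpa using h1)
  simpa using h2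

/-- If the adjacency matrices commute and the quotients of elements of any two distinct
principal sets lie in a single principal set, then the Terwilliger algebra is almost
commutative. -/
theorem SchurRing.isAlmostCommutative (S : SchurRing G)
    (hcomm : ∀ P ∈ S.principalSets, ∀ Q ∈ S.principalSets,
      adjacency P * adjacency Q = adjacency Q * adjacency P)
    (hS : ∀ P ∈ S.principalSets, ∀ Q ∈ S.principalSets, ∀ R ∈ S.principalSets, P ≠ Q →
      ∀ x ∈ P, ∀ y ∈ Q, ∀ y' ∈ Q, y * x⁻¹ ∈ R → y' * x⁻¹ ∈ R) :
    IsAlmostCommutative (terwilligerAlgebra S) 1 := by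
  classical
  intro W hW hne
  -- The dual idempotent of `{1}` would otherwise put the base vector in `W`. Applying this to
  -- `adjacency P *ᵥ w` makes the sums over principal sets vanish.
  have hone : ∀ w ∈ W, w 1 = 0 := by
    intro w hw
    by_contra h0
    refine hW.single_notMem hne ?_
    have h1 := W.smul_mem (w 1)⁻¹ (hW.1 _ (S.dualIdempotent_mem S.one_mem) w hw)
    convert h1
    ext x
    rw [Pi.smul_apply, dualIdempotent_mulVec]
    by_cases hx : x = 1
    · subst hx
      simp [h0]
    · simp [hx]
  have hsum : ∀ w ∈ W, ∀ P ∈ S.principalSets,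
      ∑ y, P.indicator (fun _ => (1 : ℂ)) y * w y = 0 := by
    intro w hw P hP
    have h1 := hone _ (hW.1 _ (S.adjacency_mem hP) w hw)
    simpa [mulVec, dotProduct, adjacency_apply] using h1
  have hblock : ∀ P ∈ S.principalSets, ∀ Q ∈ S.principalSets, ∀ R ∈ S.principalSets, P ≠ Q →
      ∀ x ∈ P, ∀ y ∈ Q, ∀ y' ∈ Q, adjacency R x y = adjacency R x y' := by
    intro P hP Q hQ R hR hPQ x hx y hy y' hy'
    have : y * x⁻¹ ∈ R ↔ y' * x⁻¹ ∈ R :=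
      ⟨hS P hP Q hQ R hR hPQ x hx y hy y' hy', hS P hP Q hQ R hR hPQ x hx y' hy' y hy⟩
    rw [adjacency_apply, adjacency_apply, Set.indicator_apply, Set.indicator_apply]
    simp only [this]
  have hAE : ∀ R ∈ S.principalSets, ∀ P ∈ S.principalSets, ∀ w ∈ W,
      adjacency R *ᵥ (dualIdempotent P *ᵥ w) = dualIdempotent P *ᵥ (adjacency R *ᵥ w) := by
    intro R hR P hP w hw
    ext x
    rw [dualIdempotent_mulVec, mulVec, mulVec, dotProduct, dotProduct]
    simp only [dualIdempotent_mulVec]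
    by_cases hx : x ∈ P
    · rw [Set.indicator_of_mem hx, one_mul, ← sub_eq_zero, ← Finset.sum_sub_distrib]
      -- This coefficient is zero on `P` and, by `hblock`, constant on every other principal set.
      have h0 := S.sum_mul_eq_zero
        (c := fun y => adjacency R x y * (P.indicator (fun _ => (1 : ℂ)) y - 1)) ?_ (hsum w hw)
      · rw [← h0]
        exact Finset.sum_congr rfl fun y _ => by ring
      · intro Q hQ y hy y' hy'
        by_cases hPQ : P = Q
        · subst hPQ
          simp [hy, hy']
        · have hn : ∀ z ∈ Q, z ∉ P := fun z hz hzP => hPQ (S.eq_of_mem hP hQ hzP hz)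
          simp only [Set.indicator_of_notMem (hn y hy), Set.indicator_of_notMem (hn y' hy'),
            hblock P hP Q hQ R hR hPQ x hx y hy y' hy']
    · rw [Set.indicator_of_notMem hx, zero_mul]
      simp only [← mul_assoc]
      refine S.sum_mul_eq_zero ?_ (hsum w hw)
      intro Q hQ y hy y' hy'
      by_cases hPQ : P = Q
      · subst hPQ
        obtain ⟨Q', ⟨hQ', hxQ'⟩, -⟩ := S.isPartition.2 x
        rw [Set.indicator_of_mem hy, Set.indicator_of_mem hy',
          hblock Q' hQ' P hP R hR (fun h => hx (h ▸ hxQ')) x hxQ' y hy y' hy']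
      · have hn : ∀ z ∈ Q, z ∉ P := fun z hz hzP => hPQ (S.eq_of_mem hP hQ hzP hz)
        rw [Set.indicator_of_notMem (hn y hy), Set.indicator_of_notMem (hn y' hy'), mul_zero,
          mul_zero]
  refine IsIrreducibleTModule.finrank_eq_one hW ?_
  rintro _ (⟨P, hP, rfl⟩ | ⟨P, hP, rfl⟩) _ (⟨Q, hQ, rfl⟩ | ⟨Q, hQ, rfl⟩) w hw
  · rw [mulVec_mulVec, mulVec_mulVec, hcomm P hP Q hQ]
  · exact hAE P hP Q hQ w hw
  · exact (hAE Q hQ P hP w hw).symm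
  · ext x
    simp only [dualIdempotent_mulVec]
    ring

end SchurRings

/-! ### `H`-classes and the group-theoretic consequences. -/

section Classes

variable {G : Type*} [Group G]

theorem hClass_ne_iff {H : Subgroup G} {x y : G} : hClass H x ≠ hClass H y ↔ x ∉ hClass H y :=
  not_congr ⟨fun h => h ▸ mem_hClass_self H x, hClass_eq_of_mem⟩

theorem hClass_eq_singleton {H : Subgroup G} {z : G}
    (hz : z ∈ Subgroup.centralizer (H : Set G)) : hClass H z = {z} := by
  ext y
  constructor
  · rintro ⟨h, hh, rfl⟩
    rw [Subgroup.mem_centralizer_iff] at hz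
    rw [Set.mem_singleton_iff, mul_assoc, ← hz h hh, inv_mul_cancel_left]
  · rintro rfl
    exact mem_hClass_self H y

theorem hClass_subset {H : Subgroup G} {g : G} (hg : g ∈ H) : hClass H g ⊆ H := by
  rintro _ ⟨h, hh, rfl⟩
  exact H.mul_mem (H.mul_mem (H.inv_mem hh) hg) hh

theorem mem_hClass_top_coe {H : Subgroup G} {x g : H} :
    x ∈ hClass (⊤ : Subgroup H) g ↔ (x : G) ∈ hClass H (g : G) := by
  constructor
  · rintro ⟨h, -, rfl⟩
    exact ⟨h, h.2, rfl⟩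
  · rintro ⟨h, hh, e⟩
    exact ⟨⟨h, hh⟩, trivial, Subtype.ext e⟩

variable [Fintype G]

/-- The adjacency matrices of conjugacy classes commute. -/
theorem adjacency_hClass_top_mul_comm (a b : G) :
    adjacency (hClass (⊤ : Subgroup G) a) * adjacency (hClass ⊤ b) =
      adjacency (hClass ⊤ b) * adjacency (hClass ⊤ a) := by
  classical
  have hconj : ∀ c u v : G, IsConj u v →
      (hClass (⊤ : Subgroup G) c).indicator (fun _ => (1 : ℂ)) u =
        (hClass (⊤ : Subgroup G) c).indicator (fun _ => (1 : ℂ)) v := by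
    intro c u v huv
    obtain ⟨k, rfl⟩ := isConj_iff.1 huv
    have := conj_mem_hClass (H := (⊤ : Subgroup G)) (h := k⁻¹) trivial u c
    rw [inv_inv] at this
    simp only [Set.indicator_apply, this]
  ext x y
  rw [Matrix.mul_apply, Matrix.mul_apply]
  -- The substitution `z ↦ y * z⁻¹ * x` swaps the two factors, up to conjugation by `y * x⁻¹`.
  refine Fintype.sum_equiv
    ((Equiv.inv G).trans ((Equiv.mulLeft y).trans (Equiv.mulRight x))) _ _ fun z => ?_
  rw [mul_comm]
  simp only [adjacency_apply, Equiv.trans_apply, Equiv.inv_apply, Equiv.coe_mulLeft,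
    Equiv.coe_mulRight]
  congr 1
  · rw [mul_inv_cancel_right]
  · refine hconj a _ _ (isConj_iff.2 ⟨y * x⁻¹, ?_⟩)
    group

/-- In a strong Gelfand pair, `ab ∈ b^H a^H`. -/
theorem IsStrongGelfandPair.exists_mul_eq {H : Subgroup G} (h : IsStrongGelfandPair H)
    (a b : G) : ∃ b' ∈ hClass H b, ∃ a' ∈ hClass H a, a * b = b' * a' := by
  classical
  have hmul : ∀ P Q : Set G, ∀ y : G, (simpleQuantity P * simpleQuantity Q).coeff y =
      ((Finset.univ.filter fun g => g ∈ P ∧ g⁻¹ * y ∈ Q).card : ℂ) := by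
    intro P Q y
    rw [simpleQuantity, Finset.sum_mul, MonoidAlgebra.coeff_sum, Finsupp.finsetSum_apply,
      Finset.card_filter, Nat.cast_sum]
    refine Finset.sum_congr rfl fun g _ => ?_
    rw [MonoidAlgebra.coeff_single_mul_apply, simpleQuantity_coeff, Set.indicator_apply,
      Set.indicator_apply, ite_and]
    split_ifs <;> simp
  have hab := h _ (Submodule.subset_span ⟨hClass H a, ⟨a, rfl⟩, rfl⟩)
    _ (Submodule.subset_span ⟨hClass H b, ⟨b, rfl⟩, rfl⟩)
  -- The coefficients at `a * b` count factorizations in the two orders; the first count is positive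
  -- because of `a * b` itself.
  have hc := congrArg (fun f : MonoidAlgebra ℂ G => f.coeff (a * b)) hab
  simp only [hmul, Nat.cast_inj] at hc
  have hpos : 0 < (Finset.univ.filter
      fun g => g ∈ hClass H b ∧ g⁻¹ * (a * b) ∈ hClass H a).card := by
    rw [← hc, Finset.card_pos]
    exact ⟨a, by simp [mem_hClass_self]⟩
  obtain ⟨g, hg⟩ := Finset.card_pos.1 hpos
  obtain ⟨-, h1, h2⟩ := Finset.mem_filter.1 hg
  exact ⟨g, h1, _, h2, by group⟩

/-- A choice of conjugators embeds `K` into `H`, as a conjugator determines the conjugate of `g`. -/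
theorem card_le_of_mul_mem_hClass {H K : Subgroup G} {g : G}
    (h : ∀ k ∈ K, k * g ∈ hClass H g) : Nat.card K ≤ Nat.card H := by
  choose f hf hfe using h
  refine Nat.card_le_card_of_injective (fun k : K => (⟨f k k.2, hf k k.2⟩ : H)) ?_
  intro k l hkl
  have hfkl : f k k.2 = f l l.2 := congrArg Subtype.val hkl
  have := hfe k k.2
  rw [hfkl, ← hfe l l.2] at this
  exact Subtype.ext (mul_right_cancel this)

variable {H : Subgroup G}

/-- If `g` and `z * g` had distinct classes, every quotient would lie in the singleton class of `z`,
forcing `g` to centralize `H`. So `z * g` is in the class of `g` for each `g` outside the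
centralizer. For `H` nonabelian such a `g` exists in `H`; for `H` abelian, counting gives equality
with the centralizer unless `H` is central, and then the pair condition makes `G` abelian. -/
theorem centralizer_le_of_quotient_mem (hG : ¬ ∀ a b : G, a * b = b * a)
    (hSGP : IsStrongGelfandPair H)
    (hS : ∀ x y : G, x ∉ hClass H y → ∀ x' ∈ hClass H x, ∀ y' ∈ hClass H y,
      y' * x'⁻¹ ∈ hClass H (y * x⁻¹)) :
    Subgroup.centralizer (H : Set G) ≤ H := by
  have hmem : ∀ z ∈ Subgroup.centralizer (H : Set G),
      ∀ g ∉ Subgroup.centralizer (H : Set G), z * g ∈ hClass H g := by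
    intro z hz g hg
    by_contra hn
    refine hg (Subgroup.mem_centralizer_iff.2 fun h hh => ?_)
    have h1 := hS g (z * g) (fun h => hn (mem_hClass_comm.1 h)) (h⁻¹ * g * h) ⟨h, hh, rfl⟩ (z * g)
      (mem_hClass_self H _)
    rw [mul_inv_cancel_right, hClass_eq_singleton hz, Set.mem_singleton_iff, mul_inv_eq_iff_eq_mul,
      mul_right_inj] at h1
    conv_lhs => rw [h1]
    group
  by_cases hH : H ≤ Subgroup.centralizer (H : Set G)
  · by_cases htop : ∀ g, g ∈ Subgroup.centralizer (H : Set G)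
    · refine absurd (fun a b => ?_) hG
      obtain ⟨b', hb', a', ha', e⟩ := hSGP.exists_mul_eq a b
      rw [hClass_eq_singleton (htop _), Set.mem_singleton_iff] at ha' hb'
      rw [e, ha', hb']
    · push Not at htop
      obtain ⟨g, hg⟩ := htop
      exact (Subgroup.eq_of_le_of_card_ge hH
        (card_le_of_mul_mem_hClass fun z hz => hmem z hz g hg)).ge
  · obtain ⟨g, hgH, hg⟩ := SetLike.not_le_iff_exists.1 hH
    intro z hz
    exact (H.mul_mem_cancel_right hgH).1 (hClass_subset hgH (hmem z hz g hg))

/-- Normality amounts to each class `g^H` lying in the coset `Hg`. -/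
theorem normal_of_quotient_mem
    (hS : ∀ x y : G, x ∉ hClass H y → ∀ x' ∈ hClass H x, ∀ y' ∈ hClass H y,
      y' * x'⁻¹ ∈ hClass H (y * x⁻¹)) :
    H.Normal := by
  have hcoset : ∀ g, ∀ x ∈ hClass H g, x * g⁻¹ ∈ H := by
    intro g x hx
    by_cases hA : ∀ h ∈ H, h * g ∈ hClass H g
    -- Here the class contains the whole coset; since it has at most `|H|` elements, the two
    -- coincide.
    · choose f hf hfe using hA
      have hinj : Function.Injective (fun k : H => (⟨f k k.2, hf k k.2⟩ : H)) := by
        intro k l hkl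
        have hfkl : f k k.2 = f l l.2 := congrArg Subtype.val hkl
        have := hfe k k.2
        rw [hfkl, ← hfe l l.2] at this
        exact Subtype.ext (mul_right_cancel this)
      obtain ⟨h, hh, rfl⟩ := hx
      obtain ⟨k, hk⟩ := (Finite.injective_iff_surjective.1 hinj) ⟨h, hh⟩
      have hk' : f k k.2 = h := congrArg Subtype.val hk
      rw [← hk', ← hfe, mul_inv_cancel_right]
      exact k.2
    · push Not at hA
      obtain ⟨h, hh, hn⟩ := hA
      -- The block condition puts `h * g * x⁻¹` in the class of `h`, hence in `H`.
      have h1 := hS g (h * g) (fun e => hn (mem_hClass_comm.1 e)) x hx (h * g)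
        (mem_hClass_self H _)
      rw [mul_inv_cancel_right] at h1
      have h2 := hClass_subset hh h1
      rw [mul_assoc, SetLike.mem_coe, H.mul_mem_cancel_left hh] at h2
      simpa using H.inv_mem h2
  refine ⟨fun h hh g => ?_⟩
  have h1 := H.mul_mem hh (hcoset g (h⁻¹ * g * h) ⟨h, hh, rfl⟩)
  convert h1 using 1
  group

theorem IsStrongGelfandPair.quotient_mul_comm [H.Normal] (hSGP : IsStrongGelfandPair H)
    (a b : G ⧸ H) : a * b = b * a := by
  have hclass : ∀ g x : G, x ∈ hClass H g → (x : G ⧸ H) = g := by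
    rintro g _ ⟨h, hh, rfl⟩
    rw [QuotientGroup.mk_mul, QuotientGroup.mk_mul, QuotientGroup.mk_inv,
      (QuotientGroup.eq_one_iff h).2 hh, inv_one, one_mul, mul_one]
  induction a using QuotientGroup.induction_on with | H a
  induction b using QuotientGroup.induction_on with | H b
  obtain ⟨b', hb', a', ha', e⟩ := hSGP.exists_mul_eq a b
  rw [← QuotientGroup.mk_mul, e, QuotientGroup.mk_mul, hclass _ _ hb', hclass _ _ ha']

end Classes

end TerwilligerSGP

/-! ### Assembly of the main theorem. -/

theorem theorem3p2 {G : Type*} [Group G] [Fintype G] [DecidableEq G]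
    (H : Subgroup G) [DecidablePred (· ∈ H)]
    (hG : ¬ ∀ a b : G, a * b = b * a)
    (hSGP : TerwilligerSGP.IsStrongGelfandPair H)
    (hAC : TerwilligerSGP.IsAlmostCommutative
      (TerwilligerSGP.terwilligerAlgebra (TerwilligerSGP.classSchurRing H)) 1) :
    TerwilligerSGP.IsAlmostCommutative
      (TerwilligerSGP.terwilligerAlgebra (TerwilligerSGP.groupSchurRing H)) 1 ∧
    Subgroup.centralizer (H : Set G) ≤ H ∧
    ∃ _ : H.Normal, ∀ a b : G ⧸ H, a * b = b * a := by
  open TerwilligerSGP in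
  have hS : ∀ x y : G, x ∉ hClass H y → ∀ x' ∈ hClass H x, ∀ y' ∈ hClass H y,
      y' * x'⁻¹ ∈ hClass H (y * x⁻¹) := fun x y hxy x' hx' y' hy' =>
    (classSchurRing H).mul_inv_mem_of_isAlmostCommutative hAC ⟨x, rfl⟩ ⟨y, rfl⟩ ⟨_, rfl⟩
      (hClass_ne_iff.2 hxy) (mem_hClass_self H x) hx' (mem_hClass_self H y) hy'
      (mem_hClass_self H _)
  refine ⟨?_, TerwilligerSGP.centralizer_le_of_quotient_mem hG hSGP hS,
    TerwilligerSGP.normal_of_quotient_mem hS, ?_⟩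
  · refine TerwilligerSGP.SchurRing.isAlmostCommutative _ ?_ ?_
    · rintro _ ⟨a, rfl⟩ _ ⟨b, rfl⟩
      exact TerwilligerSGP.adjacency_hClass_top_mul_comm a b
    · rintro _ ⟨a, rfl⟩ _ ⟨b, rfl⟩ _ ⟨c, rfl⟩ hab x hx y hy y' hy' hxy
      -- The classes are re-based at `x`, `y` and `y * x⁻¹`, so that the block condition in `G`
      -- applies to elements of `H`.
      have hx0 := TerwilligerSGP.hClass_eq_of_mem hx
      have hy0 := TerwilligerSGP.hClass_eq_of_mem hy
      rw [← hx0, ← hy0, TerwilligerSGP.hClass_ne_iff, TerwilligerSGP.mem_hClass_top_coe] at hab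
      rw [← hy0, TerwilligerSGP.mem_hClass_top_coe] at hy'
      rw [← TerwilligerSGP.hClass_eq_of_mem hxy, TerwilligerSGP.mem_hClass_top_coe]
      exact hS x y hab x (TerwilligerSGP.mem_hClass_self H _) y' hy'
  · have := TerwilligerSGP.normal_of_quotient_mem hS
    exact hSGP.quotient_mul_comm
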